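/- For probability measures $P,Q$ on the same measurable space and $\alpha>1$, let the Rényi divergence of order $\alpha$ be $$D_\alpha(P,Q)=\frac{1}{\alpha-1}\log \mathbb{E}_{x\sim Q}\Big[\Big(\frac{dP}{dQ}(x)\Big)^{\alpha}\Big]\in[0,+\infty]\quad\text{if } P\ll Q,$$ and $D_\alpha(P,Q)=+\infty$ otherwise; for random variables $X\sim P$, $Y\sim Q$ write $D_\alpha(X,Y)=D_\alpha(P,Q)$. Let $\alpha>1$, $\sigma,\sigma_z>0$, let $n_{\mathrm{syn}},d,k$ be natural numbers, and let $v,w\in\mathbb{R}^{d\times k}$ be deterministic. Let $V=v+\sigma N$ and $W=w+\sigma N'$, where each of $N,N'\in\mathbb{R}^{d\times k}$ has i.i.d. $\mathcal N(0,1)$ entries, and let $Z\in\mathbb{R}^{n_{\mathrm{syn}}\times d}$ have i.i.d. $\mathcal N(0,\sigma_z^2)$ entries and be independent of $N$ and independent of $N'$. **Proposition.** Assume $n_{\mathrm{syn}}\ge d\ge k$. Then $$D_\alpha(ZV,ZW)=D_\alpha\big(V^\top Z^\top Z V,\;W^\top Z^\top Z W\big).$$ Moreover, the map $T:\mathbb{R}^{n_{\mathrm{syn}}\times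 k}\to\mathbb{R}^{k\times k}$, $X\mapsto X^\top X$, is a sufficient statistic for the pair consisting of the law of $ZV$ and the law of $ZW$: there is a Markov kernel $\kappa$ from $\mathbb{R}^{k\times k}$ to $\mathbb{R}^{n_{\mathrm{syn}}\times k}$ such that, under each of these two laws of $X$, $\kappa(t,\cdot)$ is a version of the conditional law of $X$ given $T(X)=t$. -/

import Mathlib

open MeasureTheory ProbabilityTheory
open scoped ENNReal NNReal Matrix

/-- Real matrices carry the product (equivalently, Borel) σ-algebra. -/
instance matrixMeasurableSpace (m n : ℕ) : MeasurableSpace (Matrix (Fin m) (Fin n) ℝ) :=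
  inferInstanceAs (MeasurableSpace (Fin m → Fin n → ℝ))

/-- The Rényi divergence of order `α > 1` between two probability measures, with values in the
extended reals: `(α - 1)⁻¹ * log (E_{x ∼ Q} [(dP/dQ (x)) ^ α])` if `P ≪ Q`, and `+∞` otherwise. -/
noncomputable def renyiDivergence {E : Type*} [MeasurableSpace E] (α : ℝ) (P Q : Measure E) :
    EReal :=
  open Classical in
  if P ≪ Q then (((α - 1)⁻¹ : ℝ) : EReal) * ENNReal.log (∫⁻ x, (P.rnDeriv Q x) ^ α ∂Q) else ⊤

/-- `D_α(X, Y)`: the Rényi divergence between the laws of the random variables `X` and `Y`. -/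
noncomputable def renyiDivergenceRV {Ω E : Type*} [MeasurableSpace Ω] [MeasurableSpace E]
    (μ : Measure Ω) (α : ℝ) (X Y : Ω → E) : EReal :=
  renyiDivergence α (μ.map X) (μ.map Y)

/-- The law of an `m × n` random matrix with i.i.d. entries of law `𝓝(0, s ^ 2)`. -/
noncomputable def gaussianMatrixLaw (m n : ℕ) (s : ℝ≥0) : Measure (Matrix (Fin m) (Fin n) ℝ) :=
  Measure.pi fun _ : Fin m => Measure.pi fun _ : Fin n => gaussianReal 0 (s ^ 2)

/-- Output perturbation of the parameter `v`: the random matrix `v + σ N`. -/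
def outputPerturbation {Ω : Type*} {d k : ℕ} (σ : ℝ≥0) (N : Ω → Matrix (Fin d) (Fin k) ℝ)
    (v : Matrix (Fin d) (Fin k) ℝ) : Ω → Matrix (Fin d) (Fin k) ℝ :=
  fun ω => v + (σ : ℝ) • N ω

/-- The measurable map `T` is a sufficient statistic for the family `𝓕` of probability measures:
there is a Markov kernel `κ`, the same for all `P ∈ 𝓕`, such that `κ t` is a version of the
conditional law of `x` given `T x = t` when `x ∼ P`. -/
def IsSufficientStatistic {E F : Type*} [MeasurableSpace E] [MeasurableSpace F] (T : E → F)
    (𝓕 : Set (Measure E)) : Prop :=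
  Measurable T ∧ ∃ κ : Kernel F E, IsMarkovKernel κ ∧
    ∀ P ∈ 𝓕, P.map (fun x => (T x, x)) = (P.map T) ⊗ₘ κ

/-! The law of `Z` is unchanged by left multiplication by an orthogonal matrix. Since `Z` is
independent of `V` and of `W`, the laws of `Z V` and `Z W` inherit this invariance
(`map_gaussian_mul_orthogonal_invariant`); no density of these products is needed.

The orbits of the orthogonal group on `n × k` matrices are exactly the fibres of the Gram map. Given
its Gram matrix, an invariant random matrix is therefore Haar-distributed on the orbit, whichever
invariant law it has. This common conditional law is sufficiency
(`isSufficientStatistic_of_invariant`); its measurability rests on a measurable choice of a point in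
each orbit (`Matrix.exists_measurable_gram_section`).

Under sufficiency the likelihood ratio is a function of the statistic, so passing to the statistic
preserves the divergence (`renyiDivergence_map_of_isSufficientStatistic`). -/

section Renyi

/-! ### Sufficiency and Rényi divergence -/

variable {E F : Type*} [MeasurableSpace E] [MeasurableSpace F]

theorem map_prodMk_lintegral {T : E → F} (hT : Measurable T) {κ : Kernel F E} [IsMarkovKernel κ]
    {P : Measure E} [SFinite P] (hP : P.map (fun x => (T x, x)) = (P.map T) ⊗ₘ κ)
    {f : F × E → ℝ≥0∞} (hf : Measurable f) :
    ∫⁻ x, f (T x, x) ∂P = ∫⁻ t, ∫⁻ y, f (t, y) ∂(κ t) ∂(P.map T) := by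
  rw [← Measure.lintegral_compProd hf, ← hP, lintegral_map hf (by fun_prop)]

/-- If `P` and `Q` have the same conditional law given `T`, then the density of `P` with respect
to `Q` is the density of the laws of `T`, composed with `T`. -/
theorem eq_withDensity_rnDeriv_map {T : E → F} (hT : Measurable T) {κ : Kernel F E}
    [IsMarkovKernel κ] {P Q : Measure E} [IsFiniteMeasure P] [IsFiniteMeasure Q]
    (hP : P.map (fun x => (T x, x)) = (P.map T) ⊗ₘ κ)
    (hQ : Q.map (fun x => (T x, x)) = (Q.map T) ⊗ₘ κ) (hPQ : P.map T ≪ Q.map T) :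
    P = Q.withDensity (fun x => (P.map T).rnDeriv (Q.map T) (T x)) := by
  ext A hA
  have hκ : Measurable fun t => κ t A := κ.measurable_coe hA
  have hr := Measure.measurable_rnDeriv (P.map T) (Q.map T)
  -- Both sides become integrals of `κ t A`: against `P.map T` on the left, and against its density
  -- times `Q.map T` on the right.
  have h1 := map_prodMk_lintegral hT hP (f := fun p => A.indicator 1 p.2)
    ((measurable_one.indicator hA).comp measurable_snd)
  have h2 := map_prodMk_lintegral hT hQ
    (f := fun p => (P.map T).rnDeriv (Q.map T) p.1 * A.indicator 1 p.2)
    ((hr.comp measurable_fst).mul ((measurable_one.indicator hA).comp measurable_snd))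
  simp only [lintegral_indicator_one hA] at h1
  rw [withDensity_apply _ hA, ← lintegral_indicator hA, h1]
  have h3 : ∀ x, A.indicator (fun x => (P.map T).rnDeriv (Q.map T) (T x)) x =
      (P.map T).rnDeriv (Q.map T) (T x) * A.indicator 1 x := by
    intro x
    by_cases hx : x ∈ A <;> simp [hx]
  simp only [h3, h2]
  have h4 : ∀ t, ∫⁻ y, (P.map T).rnDeriv (Q.map T) t * A.indicator 1 y ∂(κ t) =
      (P.map T).rnDeriv (Q.map T) t * κ t A := by
    intro t
    rw [lintegral_const_mul _ (measurable_one.indicator hA), lintegral_indicator_one hA]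
  simp only [h4]
  exact (lintegral_rnDeriv_mul hPQ hκ.aemeasurable).symm

theorem renyiDivergence_map_of_isSufficientStatistic (α : ℝ) {T : E → F} {P Q : Measure E}
    [IsFiniteMeasure P] [IsFiniteMeasure Q] (h : IsSufficientStatistic T {P, Q}) :
    renyiDivergence α P Q = renyiDivergence α (P.map T) (Q.map T) := by
  obtain ⟨hT, κ, hκ, h⟩ := h
  have hP := h P (by simp)
  have hQ := h Q (by simp)
  unfold renyiDivergence
  by_cases hPQ : P.map T ≪ Q.map T
  · have hd := eq_withDensity_rnDeriv_map hT hP hQ hPQ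
    have hr := Measure.measurable_rnDeriv (P.map T) (Q.map T)
    have hac : P ≪ Q := by
      rw [hd]
      exact withDensity_absolutelyContinuous _ _
    rw [if_pos hPQ, if_pos hac]
    have hae : P.rnDeriv Q =ᵐ[Q] fun x => (P.map T).rnDeriv (Q.map T) (T x) := by
      conv_lhs => rw [hd]
      exact Measure.rnDeriv_withDensity _ (hr.comp hT)
    rw [lintegral_map (hr.pow_const α) hT]
    congr 2
    refine lintegral_congr_ae ?_
    filter_upwards [hae] with x hx
    rw [hx]
  -- Absolute continuity passes to image measures, so here both divergences are `⊤`.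
  · rw [if_neg hPQ, if_neg fun hac => hPQ (hac.map hT)]

end Renyi

/-! ### Sufficiency from group invariance -/

section GroupInvariance

variable {E F G : Type*} [MeasurableSpace E] [MeasurableSpace F] [MeasurableSpace G]

/-- If a group `G` with an invariant probability measure acts on `E`, and `T` is an invariant
statistic which has a measurable section `s` meeting every orbit, then `T` is sufficient for
every family of `G`-invariant measures. -/
theorem isSufficientStatistic_of_invariant [Group G] [MulAction G E] (ν : Measure G)
    [IsProbabilityMeasure ν] (hν : ∀ g : G, ν.map (g * ·) = ν)
    (hmul : ∀ g : G, Measurable (g * ·))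
    (hact : Measurable fun p : G × E => p.1⁻¹ • p.2) {T : E → F} {s : F → E} (hT : Measurable T)
    (hs : Measurable s) (hTinv : ∀ (g : G) x, T (g • x) = T x)
    (hsT : ∀ x, ∃ g : G, g • s (T x) = x) (𝓕 : Set (Measure E)) (hfin : ∀ P ∈ 𝓕, SFinite P)
    (hinv : ∀ P ∈ 𝓕, ∀ g : G, P.map (g • ·) = P) : IsSufficientStatistic T 𝓕 := by
  have hm : Measurable fun p : F × G => p.2⁻¹ • s p.1 :=
    hact.comp (measurable_snd.prodMk (hs.comp measurable_fst))
  have hact1 : ∀ g : G, Measurable fun x : E => g⁻¹ • x := fun g =>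
    hact.comp (measurable_const.prodMk measurable_id)
  -- The kernel sends `t` to the law of `g⁻¹ • s t` with `g ∼ ν`. The inverse turns a change of base
  -- point in the orbit into a left translation of `g`, under which `ν` is invariant.
  refine ⟨hT, (Kernel.id ×ₖ Kernel.const F ν).map (fun p : F × G => p.2⁻¹ • s p.1),
    Kernel.IsMarkovKernel.map _ hm, fun P hP => ?_⟩
  have := hfin P hP
  have : IsMarkovKernel ((Kernel.id ×ₖ Kernel.const F ν).map (fun p : F × G => p.2⁻¹ • s p.1)) :=
    Kernel.IsMarkovKernel.map _ hm
  refine Measure.ext_of_lintegral _ fun f hf => ?_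
  have hκ : ∀ t, ∫⁻ y, f (t, y) ∂((Kernel.id ×ₖ Kernel.const F ν).map
      (fun p : F × G => p.2⁻¹ • s p.1)) t = ∫⁻ g, f (t, g⁻¹ • s t) ∂ν := by
    intro t
    have hft : Measurable fun y => f (t, y) := hf.comp measurable_prodMk_left
    rw [Kernel.lintegral_map _ hm _ hft, Kernel.prod_apply, Kernel.id_apply, Kernel.const_apply,
      Measure.dirac_prod,
      lintegral_map (f := fun p : F × G => f (t, p.2⁻¹ • s p.1)) (hft.comp hm)
        measurable_prodMk_left]
  rw [lintegral_map hf (by fun_prop), Measure.lintegral_compProd hf]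
  simp only [hκ]
  rw [lintegral_map _ hT]
  swap
  · exact Measurable.lintegral_prod_right'
      (f := fun p : F × G => f (p.1, p.2⁻¹ • s p.1)) (hf.comp (measurable_fst.prodMk hm))
  have h1 : ∀ x, ∫⁻ g, f (T x, g⁻¹ • s (T x)) ∂ν = ∫⁻ g : G, f (T (g⁻¹ • x), g⁻¹ • x) ∂ν := by
    intro x
    obtain ⟨g₀, hg₀⟩ := hsT x
    have hmeas : Measurable fun g : G => f (T x, g⁻¹ • x) :=
      hf.comp (measurable_const.prodMk (hact.comp (measurable_id.prodMk measurable_const)))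
    simp only [hTinv]
    conv_rhs => rw [← hν g₀, lintegral_map hmeas (hmul g₀)]
    refine lintegral_congr fun g => ?_
    rw [mul_inv_rev, mul_smul, inv_smul_eq_iff.2 hg₀.symm]
  simp only [h1]
  rw [lintegral_lintegral_swap]
  swap
  · refine Measurable.aemeasurable ?_
    have h2 : Measurable fun p : E × G => p.2⁻¹ • p.1 := hact.comp measurable_swap
    exact hf.comp ((hT.comp h2).prodMk h2)
  -- After the swap, invariance of `P` removes `g` from the inner integral, and `ν` has mass one.
  have h3 : ∀ g : G, ∫⁻ x, f (T (g⁻¹ • x), g⁻¹ • x) ∂P = ∫⁻ x, f (T x, x) ∂P := by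
    intro g
    conv_rhs => rw [← hinv P hP g⁻¹,
      lintegral_map (f := fun x => f (T x, x)) (hf.comp (hT.prodMk measurable_id)) (hact1 g)]
  simp [h3]

end GroupInvariance

/-! ### Orbits are the fibres of the Gram map -/

section Gram

/-- Two linear maps into a finite-dimensional inner product space with the same pullback norm
differ by a linear isometry of the target. -/
theorem exists_linearIsometryEquiv_of_norm_eq {M E : Type*} [AddCommGroup M] [Module ℝ M]
    [NormedAddCommGroup E] [InnerProductSpace ℝ E] [FiniteDimensional ℝ E] (f g : M →ₗ[ℝ] E)
    (h : ∀ a, ‖f a‖ = ‖g a‖) : ∃ U : E ≃ₗᵢ[ℝ] E, ∀ a, U (g a) = f a := by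
  have hker : LinearMap.ker g ≤ LinearMap.ker f := fun a ha => by
    rw [LinearMap.mem_ker] at ha ⊢
    rw [← norm_eq_zero, h, ha, norm_zero]
  -- The isometry `g a ↦ f a` on the range of `g` is well defined because equal norms force equal
  -- kernels; it then extends to all of `E`.
  let L₀ : LinearMap.range g →ₗ[ℝ] E :=
    (LinearMap.ker g).liftQ f hker ∘ₗ g.quotKerEquivRange.symm.toLinearMap
  have hL₀ : ∀ a, L₀ ⟨g a, LinearMap.mem_range_self g a⟩ = f a := by
    intro a
    have : g.quotKerEquivRange.symm ⟨g a, LinearMap.mem_range_self g a⟩ =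
        (LinearMap.ker g).mkQ a := by
      rw [LinearEquiv.symm_apply_eq]
      rfl
    simp [L₀, this]
  let L : LinearMap.range g →ₗᵢ[ℝ] E := ⟨L₀, by
    rintro ⟨_, a, rfl⟩
    rw [hL₀, h]
    rfl⟩
  refine ⟨L.extend.toLinearIsometryEquiv rfl, fun a => ?_⟩
  have := L.extend_apply ⟨g a, LinearMap.mem_range_self g a⟩
  simpa using this.trans (hL₀ a)

/-- The Gram matrix determines `‖X a‖` for every vector `a`, so the isometry extension applies. -/
theorem Matrix.exists_orthogonal_mul_eq {n k : ℕ} {X Y : Matrix (Fin n) (Fin k) ℝ}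
    (h : Xᵀ * X = Yᵀ * Y) : ∃ U : Matrix.orthogonalGroup (Fin n) ℝ, U.1 * Y = X := by
  have hnorm : ∀ (A : Matrix (Fin n) (Fin k) ℝ) (a : EuclideanSpace ℝ (Fin k)),
      ‖A.toEuclideanLin a‖ ^ 2 = a.ofLp ⬝ᵥ (Aᵀ * A) *ᵥ a.ofLp := by
    intro A a
    rw [EuclideanSpace.real_norm_sq_eq, ← Matrix.mulVec_mulVec, Matrix.dotProduct_mulVec,
      Matrix.vecMul_transpose]
    simp [dotProduct, sq]
  obtain ⟨U, hU⟩ := exists_linearIsometryEquiv_of_norm_eq X.toEuclideanLin Y.toEuclideanLin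
    fun a => by
      rw [← sq_eq_sq₀ (norm_nonneg _) (norm_nonneg _), hnorm, hnorm, h]
  let b := EuclideanSpace.basisFun (Fin n) ℝ
  refine ⟨⟨_, U.toMatrix_mem_unitaryGroup b b⟩, ?_⟩
  apply Matrix.toEuclideanLin.injective
  refine LinearMap.ext fun a => ?_
  have hM : (LinearMap.toMatrix b.toBasis b.toBasis U.toLinearEquiv.toLinearMap).toEuclideanLin =
      U.toLinearEquiv.toLinearMap := by
    rw [Matrix.toEuclideanLin_eq_toLin_orthonormal, Matrix.toLin_toMatrix]
  have hMa : ∀ y, (LinearMap.toMatrix b.toBasis b.toBasis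
      U.toLinearEquiv.toLinearMap).toEuclideanLin y = U y := fun y => by rw [hM]; rfl
  rw [← hU, ← hMa]
  ext i
  simp only [Matrix.ofLp_toLpLin, Matrix.toLin'_apply, Matrix.mulVec_mulVec]

end Gram

/-! ### Haar probability on the orthogonal group -/

section OrthogonalGroup

instance orthogonalGroup.compactSpace (n : ℕ) :
    CompactSpace (Matrix.orthogonalGroup (Fin n) ℝ) := by
  refine isCompact_iff_compactSpace (s := (unitary (Matrix (Fin n) (Fin n) ℝ) : Set (Matrix (Fin n) (Fin n) ℝ))).1 ?_
  have hK : IsCompact (Set.univ.pi fun _ : Fin n => Set.univ.pi fun _ : Fin n =>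
      Set.Icc (-1 : ℝ) 1) := isCompact_univ_pi fun _ => isCompact_univ_pi fun _ => isCompact_Icc
  refine IsCompact.of_isClosed_subset hK (isClosed_unitary (R := Matrix (Fin n) (Fin n) ℝ)) ?_
  intro U hU i _ j _
  exact abs_le.1 (entry_norm_bound_of_unitary hU i j)

/-- The orthogonal group carries an invariant probability measure. -/
theorem exists_isProbabilityMeasure_orthogonalGroup (n : ℕ)
    [MeasurableSpace (Matrix.orthogonalGroup (Fin n) ℝ)]
    [BorelSpace (Matrix.orthogonalGroup (Fin n) ℝ)] :
    ∃ ν : Measure (Matrix.orthogonalGroup (Fin n) ℝ), IsProbabilityMeasure ν ∧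
      ∀ g, ν.map (g * ·) = ν :=
  ⟨Measure.haarMeasure ⊤, ⟨Measure.haarMeasure_self⟩, fun g => map_mul_left_eq_self _ g⟩

end OrthogonalGroup

/-! ### A measurable section of the Gram map -/

section GramSection

instance matrixBorelSpace (m n : ℕ) : BorelSpace (Matrix (Fin m) (Fin n) ℝ) :=
  inferInstanceAs (BorelSpace (Fin m → Fin n → ℝ))

instance matrixPolishSpace (m n : ℕ) : PolishSpace (Matrix (Fin m) (Fin n) ℝ) :=
  inferInstanceAs (PolishSpace (Fin m → Fin n → ℝ))

theorem Matrix.isClosed_setOf_posSemidef (k : ℕ) :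
    IsClosed {B : Matrix (Fin k) (Fin k) ℝ | B.PosSemidef} := by
  simp only [Matrix.posSemidef_iff_dotProduct_mulVec, Set.ofPred_and, Set.ofPred_forall]
  refine IsClosed.inter ?_ (isClosed_iInter fun x => ?_)
  · exact isClosed_eq (by fun_prop) (by fun_prop)
  · exact isClosed_le (by fun_prop) (by fun_prop)

-- Squaring is continuous and injective on the closed set of positive semidefinite matrices, hence a
-- measurable embedding (Lusin–Souslin) whose inverse extends measurably.
open scoped MatrixOrder in
theorem Matrix.exists_measurable_sqrt (k : ℕ) :
    ∃ r : Matrix (Fin k) (Fin k) ℝ → Matrix (Fin k) (Fin k) ℝ, Measurable r ∧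
      ∀ A, A.PosSemidef → (r A).PosSemidef ∧ r A * r A = A := by
  have hinj : Set.InjOn (fun B : Matrix (Fin k) (Fin k) ℝ => B * B) {B | B.PosSemidef} := by
    intro A hA B hB hAB
    rw [← CFC.sqrt_mul_self A hA.nonneg, ← CFC.sqrt_mul_self B hB.nonneg]
    exact congrArg _ hAB
  have hemb := ContinuousOn.measurableEmbedding
    (Matrix.isClosed_setOf_posSemidef k).measurableSet
    (Continuous.continuousOn (by fun_prop)) hinj
  obtain ⟨r, hr, hrc⟩ := hemb.exists_measurable_extend measurable_subtype_coe fun _ => ⟨0⟩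
  refine ⟨r, hr, fun A hA => ?_⟩
  have hps : (CFC.sqrt A).PosSemidef := Matrix.nonneg_iff_posSemidef.1 (CFC.sqrt_nonneg A)
  have hsq : CFC.sqrt A * CFC.sqrt A = A := CFC.sqrt_mul_sqrt_self A hA.nonneg
  have := congrFun hrc ⟨CFC.sqrt A, hps⟩
  simp only [Function.comp_apply, Set.domRestrict_apply, hsq] at this
  rw [this]
  exact ⟨hps, hsq⟩

theorem Matrix.measurable_mul {X : Type*} [MeasurableSpace X] {l m n : ℕ}
    {f : X → Matrix (Fin l) (Fin m) ℝ} {g : X → Matrix (Fin m) (Fin n) ℝ} (hf : Measurable f)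
    (hg : Measurable g) : Measurable fun x => f x * g x :=
  Continuous.measurable2 (by fun_prop) hf hg

theorem Matrix.exists_measurable_gram_section {n k : ℕ} (h : k ≤ n) :
    ∃ s : Matrix (Fin k) (Fin k) ℝ → Matrix (Fin n) (Fin k) ℝ, Measurable s ∧
      ∀ X : Matrix (Fin n) (Fin k) ℝ, (s (Xᵀ * X))ᵀ * s (Xᵀ * X) = Xᵀ * X := by
  obtain ⟨r, hr, hrA⟩ := Matrix.exists_measurable_sqrt k
  -- The first `k` columns of the identity: an isometric embedding that pads the `k × k` square root
  -- to `n` rows.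
  let C : Matrix (Fin n) (Fin k) ℝ := (1 : Matrix (Fin n) (Fin n) ℝ).submatrix id (Fin.castLE h)
  have hC : Cᵀ * C = 1 := by
    simp only [C, Matrix.transpose_submatrix, Matrix.transpose_one]
    rw [← Matrix.submatrix_mul _ _ _ _ _ Function.bijective_id, Matrix.one_mul,
      Matrix.submatrix_one _ (Fin.castLE_injective h)]
  refine ⟨fun A => C * r A, Matrix.measurable_mul measurable_const hr, fun X => ?_⟩
  have hX : (Xᵀ * X).PosSemidef := by
    simpa using Matrix.posSemidef_conjTranspose_mul_self X
  obtain ⟨hps, hsq⟩ := hrA _ hX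
  have hsymm : (r (Xᵀ * X))ᵀ = r (Xᵀ * X) := by simpa using hps.isHermitian.eq
  rw [Matrix.transpose_mul, hsymm, Matrix.mul_assoc, ← Matrix.mul_assoc Cᵀ, hC, Matrix.one_mul,
    hsq]

end GramSection

/-! ### Rotation invariance of Gaussian matrices -/

section Gaussian

theorem gaussianMatrixLaw_one_eq_map (m n : ℕ) :
    gaussianMatrixLaw m n 1 = (Measure.pi fun _ : Fin m × Fin n => gaussianReal 0 1).map
      (fun x => Matrix.of (Function.curry x)) := by
  have := Measure.infinitePi_map_curry (fun (_ : Fin m) (_ : Fin n) => gaussianReal 0 1)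
  simp only [Measure.infinitePi_eq_pi] at this
  rw [gaussianMatrixLaw, one_pow]
  exact this.symm

theorem gaussianMatrixLaw_eq_map_smul (m n : ℕ) (s : ℝ≥0) :
    gaussianMatrixLaw m n s = (gaussianMatrixLaw m n 1).map ((s : ℝ) • ·) := by
  have hg : (gaussianReal 0 1).map ((s : ℝ) * ·) = gaussianReal 0 (s ^ 2) := by
    rw [gaussianReal_map_const_mul, mul_zero, mul_one]
    rfl
  have h1 : (Measure.pi fun _ : Fin n => gaussianReal 0 1).map (fun x j => (s : ℝ) * x j) =
      Measure.pi fun _ : Fin n => gaussianReal 0 (s ^ 2) := by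
    have : ∀ _ : Fin n, SigmaFinite ((gaussianReal 0 1).map ((s : ℝ) * ·)) := by
      rw [hg]
      infer_instance
    rw [Measure.pi_map_pi fun _ => by fun_prop, hg]
  have h2 : (Measure.pi fun _ : Fin m => Measure.pi fun _ : Fin n => gaussianReal 0 1).map
      (fun x i j => (s : ℝ) * x i j) =
      Measure.pi fun _ : Fin m => Measure.pi fun _ : Fin n => gaussianReal 0 (s ^ 2) := by
    have : ∀ _ : Fin m, SigmaFinite ((Measure.pi fun _ : Fin n => gaussianReal 0 1).map
        (fun x j => (s : ℝ) * x j)) := by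
      rw [h1]
      infer_instance
    rw [Measure.pi_map_pi (f := fun (_ : Fin m) (x : Fin n → ℝ) j => (s : ℝ) * x j)
      fun _ => Measurable.aemeasurable (by fun_prop), h1]
  rw [gaussianMatrixLaw, gaussianMatrixLaw, one_pow]
  exact h2.symm

/-- Flattening the matrix makes the isometry invariance of `stdGaussian` available. -/
theorem gaussianMatrixLaw_one_eq_map_stdGaussian (m n : ℕ) :
    gaussianMatrixLaw m n 1 = (stdGaussian (EuclideanSpace ℝ (Fin m × Fin n))).map
      (fun x => Matrix.of (Function.curry x.ofLp)) := by
  have h : Measurable fun x : EuclideanSpace ℝ (Fin m × Fin n) =>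
      Matrix.of (Function.curry x.ofLp) :=
    (MeasurableEquiv.curry (Fin m) (Fin n) ℝ).measurable.comp
      (PiLp.continuous_ofLp 2 _).measurable
  rw [gaussianMatrixLaw_one_eq_map, ← map_pi_eq_stdGaussian, Measure.map_map h (by fun_prop)]
  rfl

/-- Left multiplication by an orthogonal matrix, as an isometry for the Frobenius norm. -/
noncomputable def orthogonalMulLinearIsometry {m : ℕ} (n : ℕ)
    (U : Matrix.orthogonalGroup (Fin m) ℝ) :
    EuclideanSpace ℝ (Fin m × Fin n) →ₗᵢ[ℝ] EuclideanSpace ℝ (Fin m × Fin n) where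
  toFun x := WithLp.toLp 2 fun p => (U.1 * Matrix.of (Function.curry x.ofLp)) p.1 p.2
  map_add' x y := by
    ext p
    simp [Matrix.mul_apply, Function.curry, mul_add, Finset.sum_add_distrib]
  map_smul' c x := by
    ext p
    simp [Matrix.mul_apply, Function.curry, Finset.mul_sum, mul_left_comm]
  norm_map' x := by
    have htr : ∀ A : Matrix (Fin m) (Fin n) ℝ,
        ‖(WithLp.toLp 2 fun p => A p.1 p.2 : EuclideanSpace ℝ (Fin m × Fin n))‖ ^ 2 =
          (Aᵀ * A).trace := by
      intro A
      rw [EuclideanSpace.real_norm_sq_eq, Fintype.sum_prod_type_right]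
      simp [Matrix.trace, Matrix.mul_apply, sq]
    have hU : U.1ᵀ * U.1 = 1 := (Matrix.mem_orthogonalGroup_iff' _ _).1 U.2
    rw [← sq_eq_sq₀ (norm_nonneg _) (norm_nonneg _)]
    refine (htr _).trans (Eq.trans ?_ (htr (Matrix.of (Function.curry x.ofLp))).symm)
    rw [Matrix.transpose_mul, Matrix.mul_assoc, ← Matrix.mul_assoc _ U.1, hU,
      Matrix.one_mul]

theorem gaussianMatrixLaw_map_orthogonal_mul {m n : ℕ} (s : ℝ≥0)
    (U : Matrix.orthogonalGroup (Fin m) ℝ) :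
    (gaussianMatrixLaw m n s).map (U.1 * ·) = gaussianMatrixLaw m n s := by
  have hmU : Measurable fun A : Matrix (Fin m) (Fin n) ℝ => U.1 * A :=
    Matrix.measurable_mul measurable_const measurable_id
  have hms : Measurable fun A : Matrix (Fin m) (Fin n) ℝ => (s : ℝ) • A :=
    (continuous_const_smul (s : ℝ)).measurable
  have h1 : (gaussianMatrixLaw m n 1).map (U.1 * ·) = gaussianMatrixLaw m n 1 := by
    have h : Measurable fun x : EuclideanSpace ℝ (Fin m × Fin n) =>
        Matrix.of (Function.curry x.ofLp) :=
      (MeasurableEquiv.curry (Fin m) (Fin n) ℝ).measurable.comp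
        (PiLp.continuous_ofLp 2 _).measurable
    rw [gaussianMatrixLaw_one_eq_map_stdGaussian, Measure.map_map hmU h]
    conv_rhs => rw [← stdGaussian_map ((orthogonalMulLinearIsometry n U).toLinearIsometryEquiv rfl),
      Measure.map_map h (LinearIsometryEquiv.continuous _).measurable]
    rfl
  rw [gaussianMatrixLaw_eq_map_smul, Measure.map_map hmU hms]
  conv_rhs => rw [← h1, Measure.map_map hms hmU]
  congr 1
  ext1 A
  exact Matrix.mul_smul _ _ _

end Gaussian

/-! ### The Gram matrix as sufficient statistic -/

/-- The orthogonal group acts on rectangular matrices by left multiplication. -/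
@[reducible] def orthogonalMulAction (n k : ℕ) :
    MulAction (Matrix.orthogonalGroup (Fin n) ℝ) (Matrix (Fin n) (Fin k) ℝ) where
  smul U X := U.1 * X
  one_smul X := Matrix.one_mul X
  mul_smul U U' X := Matrix.mul_assoc U.1 U' X

/-- The Gram matrix is sufficient for every family of measures that are invariant under left
multiplication by orthogonal matrices. -/
theorem isSufficientStatistic_gram {n k : ℕ} (hkn : k ≤ n)
    (𝓕 : Set (Measure (Matrix (Fin n) (Fin k) ℝ))) (hfin : ∀ P ∈ 𝓕, SFinite P)
    (hinv : ∀ P ∈ 𝓕, ∀ U : Matrix.orthogonalGroup (Fin n) ℝ,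
      P.map (U.1 * ·) = P) :
    IsSufficientStatistic (fun X : Matrix (Fin n) (Fin k) ℝ => Xᵀ * X) 𝓕 := by
  let := orthogonalMulAction n k
  let : MeasurableSpace (Matrix.orthogonalGroup (Fin n) ℝ) := borel _
  have : BorelSpace (Matrix.orthogonalGroup (Fin n) ℝ) := ⟨rfl⟩
  obtain ⟨ν, hν, hνinv⟩ := exists_isProbabilityMeasure_orthogonalGroup n
  obtain ⟨s, hs, hsX⟩ := Matrix.exists_measurable_gram_section hkn
  refine isSufficientStatistic_of_invariant ν hνinv
    (fun U => (continuous_const_mul U).measurable) ?_ ?_ hs ?_ ?_ 𝓕 hfin hinv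
  · have h : Measurable fun U : Matrix.orthogonalGroup (Fin n) ℝ =>
        ((U⁻¹ : Matrix.orthogonalGroup (Fin n) ℝ) : Matrix (Fin n) (Fin n) ℝ) :=
      (continuous_subtype_val.comp continuous_inv).measurable
    exact Matrix.measurable_mul (h.comp measurable_fst) measurable_snd
  · exact Continuous.measurable (by fun_prop)
  · intro U X
    change (U.1 * X)ᵀ * (U.1 * X) = Xᵀ * X
    have hU : U.1ᵀ * U.1 = 1 := (Matrix.mem_orthogonalGroup_iff' _ _).1 U.2
    rw [Matrix.transpose_mul, Matrix.mul_assoc, ← Matrix.mul_assoc _ U.1, hU,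
      Matrix.one_mul]
  · exact fun X => Matrix.exists_orthogonal_mul_eq (hsX X).symm

/-- The product of a Gaussian matrix with an independent random matrix is invariant in law under
left multiplication by orthogonal matrices. -/
theorem map_gaussian_mul_orthogonal_invariant {Ω : Type*} [MeasurableSpace Ω] {μ : Measure Ω}
    [IsProbabilityMeasure μ] {n d k : ℕ} {s : ℝ≥0} {Z : Ω → Matrix (Fin n) (Fin d) ℝ}
    {V : Ω → Matrix (Fin d) (Fin k) ℝ} (hZ : HasLaw Z (gaussianMatrixLaw n d s) μ)
    (hV : AEMeasurable V μ) (hZV : IndepFun Z V μ) (U : Matrix.orthogonalGroup (Fin n) ℝ) :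
    (μ.map fun ω => Z ω * V ω).map (U.1 * ·) = μ.map fun ω => Z ω * V ω := by
  have hmU : ∀ l, Measurable fun A : Matrix (Fin n) (Fin l) ℝ => U.1 * A :=
    fun l => Matrix.measurable_mul measurable_const measurable_id
  have hmul : Measurable fun p : Matrix (Fin n) (Fin d) ℝ × Matrix (Fin d) (Fin k) ℝ =>
      p.1 * p.2 := Matrix.measurable_mul measurable_fst measurable_snd
  have hlaw : μ.map (fun ω => Z ω * V ω) =
      ((gaussianMatrixLaw n d s).prod (μ.map V)).map fun p => p.1 * p.2 := by
    rw [← hZ.map_eq, ← (indepFun_iff_map_prod_eq_prod_map_map hZ.aemeasurable hV).1 hZV,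
      AEMeasurable.map_map_of_aemeasurable hmul.aemeasurable (hZ.aemeasurable.prodMk hV)]
    rfl
  have : IsProbabilityMeasure (μ.map V) := Measure.isProbabilityMeasure_map hV
  have : IsProbabilityMeasure (gaussianMatrixLaw n d s) := by
    rw [← hZ.map_eq]
    exact Measure.isProbabilityMeasure_map hZ.aemeasurable
  -- Rotating only the Gaussian factor preserves the product law; associativity moves the rotation
  -- outside the matrix product.
  have hprod : ((gaussianMatrixLaw n d s).prod (μ.map V)).map
      (Prod.map (U.1 * ·) id) = (gaussianMatrixLaw n d s).prod (μ.map V) := by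
    rw [← Measure.map_prod_map _ _ (hmU d) measurable_id, gaussianMatrixLaw_map_orthogonal_mul,
      Measure.map_id]
  rw [hlaw, Measure.map_map (hmU k) hmul]
  conv_rhs => rw [← hprod, Measure.map_map hmul ((hmU d).prodMap measurable_id)]
  congr 1
  ext1 p
  exact (Matrix.mul_assoc _ _ _).symm

theorem measurable_outputPerturbation_apply {d k : ℕ} (σ : ℝ≥0) (v : Matrix (Fin d) (Fin k) ℝ) :
    Measurable fun A : Matrix (Fin d) (Fin k) ℝ => v + (σ : ℝ) • A :=
  Continuous.measurable (by fun_prop)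

theorem mainTheorem9 {Ω : Type*} [MeasurableSpace Ω] (μ : Measure Ω) [IsProbabilityMeasure μ]
    (nsyn d k : ℕ) (hnd : d ≤ nsyn) (hdk : k ≤ d)
    (α : ℝ) (hα : 1 < α) (σ σz : ℝ≥0) (hσ : 0 < σ) (hσz : 0 < σz)
    (v w : Matrix (Fin d) (Fin k) ℝ)
    (N N' : Ω → Matrix (Fin d) (Fin k) ℝ) (Z : Ω → Matrix (Fin nsyn) (Fin d) ℝ)
    (hN : HasLaw N (gaussianMatrixLaw d k 1) μ) (hN' : HasLaw N' (gaussianMatrixLaw d k 1) μ)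
    (hZ : HasLaw Z (gaussianMatrixLaw nsyn d σz) μ)
    (hZN : IndepFun Z N μ) (hZN' : IndepFun Z N' μ)
    (V W : Ω → Matrix (Fin d) (Fin k) ℝ)
    (hV : V = outputPerturbation σ N v) (hW : W = outputPerturbation σ N' w) :
    renyiDivergenceRV μ α (fun ω => Z ω * V ω) (fun ω => Z ω * W ω) =
        renyiDivergenceRV μ α (fun ω => (V ω)ᵀ * (Z ω)ᵀ * Z ω * V ω)
          (fun ω => (W ω)ᵀ * (Z ω)ᵀ * Z ω * W ω) ∧
      IsSufficientStatistic (fun X : Matrix (Fin nsyn) (Fin k) ℝ => Xᵀ * X)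
        {μ.map (fun ω => Z ω * V ω), μ.map (fun ω => Z ω * W ω)} := by
  have key : ∀ (u : Matrix (Fin d) (Fin k) ℝ) (M : Ω → Matrix (Fin d) (Fin k) ℝ),
      HasLaw M (gaussianMatrixLaw d k 1) μ → IndepFun Z M μ →
      AEMeasurable (fun ω => Z ω * outputPerturbation σ M u ω) μ ∧
        ∀ U : Matrix.orthogonalGroup (Fin nsyn) ℝ,
          (μ.map fun ω => Z ω * outputPerturbation σ M u ω).map (U.1 * ·) =
            μ.map fun ω => Z ω * outputPerturbation σ M u ω := by
    intro u M hM hZM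
    have hu := measurable_outputPerturbation_apply σ u
    have hm : AEMeasurable (outputPerturbation σ M u) μ := hu.comp_aemeasurable hM.aemeasurable
    have hmul : Measurable fun p : Matrix (Fin nsyn) (Fin d) ℝ × Matrix (Fin d) (Fin k) ℝ =>
        p.1 * p.2 := Matrix.measurable_mul measurable_fst measurable_snd
    exact ⟨hmul.comp_aemeasurable (hZ.aemeasurable.prodMk hm),
      map_gaussian_mul_orthogonal_invariant hZ hm (hZM.comp measurable_id hu)⟩
  subst hV hW
  obtain ⟨hmV, hinvV⟩ := key v N hN hZN
  obtain ⟨hmW, hinvW⟩ := key w N' hN' hZN'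
  have hPV := Measure.isProbabilityMeasure_map hmV
  have hPW := Measure.isProbabilityMeasure_map hmW
  have hsuff := isSufficientStatistic_gram (hdk.trans hnd)
    {μ.map (fun ω => Z ω * outputPerturbation σ N v ω),
      μ.map (fun ω => Z ω * outputPerturbation σ N' w ω)}
    (by
      rintro P (rfl | rfl)
      · infer_instance
      · infer_instance)
    (by
      rintro P (rfl | rfl)
      · exact hinvV
      · exact hinvW)
  refine ⟨?_, hsuff⟩
  have h := renyiDivergence_map_of_isSufficientStatistic α hsuff
  rw [AEMeasurable.map_map_of_aemeasurable hsuff.1.aemeasurable hmV,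
    AEMeasurable.map_map_of_aemeasurable hsuff.1.aemeasurable hmW] at h
  simpa only [renyiDivergenceRV, Function.comp_def, Matrix.transpose_mul, Matrix.mul_assoc] using h
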